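/- For each choice of the sign, the Diophantine equation $x^3 \pm y^3 = a^4 + b^4$ has infinitely many nontrivial solutions in positive integers. Here a quadruple $(x, y, a, b)$ of integers satisfying the equation is called a nontrivial solution if $\gcd(x, y, a, b) = 1$ and no partial sum of the expression $x^3 \pm y^3 - (a^4 + b^4)$ vanishes, that is, the sum over every nonempty proper subset of the four terms $x^3,\ \pm y^3,\ -a^4,\ -b^4$ is nonzero. -/

import Mathlib

/-- The four signed terms of the expression `x ^ 3 + ε * y ^ 3 - (a ^ k + δ * b ^ k)`,
where the signs `ε` and `δ` are units of `ℤ`, that is, `1` or `-1`. -/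
def signedTerms (k : ℕ) (ε δ : ℤˣ) (x y a b : ℤ) : Fin 4 → ℤ :=
  ![x ^ 3, (ε : ℤ) * y ^ 3, -a ^ k, -((δ : ℤ) * b ^ k)]

/-- `(x, y, a, b)` is a nontrivial solution of `x ^ 3 + ε * y ^ 3 = a ^ k + δ * b ^ k`: it solves
the equation, the greatest common divisor of the four integers is `1`, and no partial sum (the sum
over a nonempty proper subset of the four terms) of `x ^ 3 + ε * y ^ 3 - (a ^ k + δ * b ^ k)`
vanishes. -/
structure IsNontrivialSolution (k : ℕ) (ε δ : ℤˣ) (x y a b : ℤ) : Prop where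
  equation : x ^ 3 + (ε : ℤ) * y ^ 3 = a ^ k + (δ : ℤ) * b ^ k
  coprime : Nat.gcd (Int.gcd x y) (Int.gcd a b) = 1
  partial_sum_ne_zero : ∀ S : Finset (Fin 4), S.Nonempty → S ≠ Finset.univ →
    ∑ i ∈ S, signedTerms k ε δ x y a b i ≠ 0

/-!
The proof exhibits two elliptic curves whose rational points give solutions.

Put `a = m * f + n ^ 3`, `b = n * f - m ^ 3` and `x + y = m ^ 4 + n ^ 4`. Then `m ^ 4 + n ^ 4` divides
`a ^ 4 + b ^ 4`, and with `x - y = d` the equation `x ^ 3 + y ^ 3 = a ^ 4 + b ^ 4` becomes an equation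
`3 * d ^ 2 = F(m, n, f)`, quartic in `f` (`IsFibrePoint`). Its solution `f = 0`, `d = m ^ 4 - n ^ 4` is
the trivial one. For `f = k * (m ^ 2 - n ^ 2)` with a constant `k`, the right hand side is divisible
by `(m ^ 2 - n ^ 2) ^ 2`, and what is left is a curve of genus one in `t = m / n` (`IsCurvePoint`).
A positive `y` means `|d| < m ^ 4 + n ^ 4`, a negative one means `|d| > m ^ 4 + n ^ 4`, so the sign in
the theorem is decided by the position of `t` on the real line.

* For `k = 4 / 3` the curve has rational points at `t = 1`, near which `|d| < m ^ 4 + n ^ 4`.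
* For `k = 6` it has rational points at `t = -3`, near which `|d| > m ^ 4 + n ^ 4`.

In both cases rational points accumulate at the given one. The resolvent cubic has infinitely many
rational points, since repeated doubling of a point with `2`-adically nonintegral abscissa makes the
abscissa `2`-adically larger and larger (`cubicPoints_infinite`). By compactness, differences of these
points have arbitrarily large real abscissa (`exists_cubicPoints_gt`), and large abscissae correspond
to points of the quartic near the given one (`exists_quartic_point_near_zero`).

No common factor can occur: an odd prime dividing `a` and `b` divides `m ^ 4 + n ^ 4` and
`2 * p ^ 2 - q ^ 2`, where `k = p / q`. The latter number is `23` for `k = 4 / 3` and `71` for `k = 6`,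
and neither of these primes divides a sum of two coprime fourth powers
(`IsFibrePoint.gcd_eq_one`). Finally a partial sum can vanish only if `x` and `y` are fourth powers,
which is excluded by the equality case of Young's inequality
(`eq_cube_of_cubes_eq_fourth_powers`).
-/

/-! ### Rational points on cubic curves -/

/-- The rational points of the affine cubic curve `y ^ 2 = x ^ 3 + A * x ^ 2 + B * x + C`. -/
def cubicPoints (A B C : ℤ) : Set (ℚ × ℚ) :=
  {P | P.2 ^ 2 = P.1 ^ 3 + A * P.1 ^ 2 + B * P.1 + C}

/-- The abscissa is that of the difference of the two points: the chord passes through `(x₁, y₁)`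
and `(x₂, -y₂)`. -/
theorem cubicPoints_chord {A B C : ℤ} {x₁ y₁ x₂ y₂ : ℚ} (h₁ : (x₁, y₁) ∈ cubicPoints A B C)
    (h₂ : (x₂, y₂) ∈ cubicPoints A B C) (hx : x₁ ≠ x₂) :
    ∃ y, (((y₁ + y₂) / (x₁ - x₂)) ^ 2 - A - x₁ - x₂, y) ∈ cubicPoints A B C := by
  simp only [cubicPoints, Set.mem_ofPred_eq] at h₁ h₂ ⊢
  have hne : x₁ - x₂ ≠ 0 := sub_ne_zero.mpr hx
  obtain ⟨l, hl⟩ : ∃ l, l = (y₁ + y₂) / (x₁ - x₂) := ⟨_, rfl⟩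
  have hl' : l * (x₁ - x₂) = y₁ + y₂ := by rw [hl]; field_simp
  rw [← hl]
  refine ⟨y₁ + l * (l ^ 2 - A - x₁ - x₂ - x₁), ?_⟩
  -- eliminate `y₂`, then cancel the factor `x₁ - x₂`
  have hy : y₂ = l * (x₁ - x₂) - y₁ := by linarith
  subst hy
  have key : 2 * l * y₁ = l ^ 2 * (x₁ - x₂) - (A * (x₁ + x₂) + B + x₁ ^ 2 + x₁ * x₂ + x₂ ^ 2)
      + 2 * (x₁ ^ 2 + x₁ * x₂ + x₂ ^ 2 + A * (x₁ + x₂) + B) := by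
    apply mul_left_cancel₀ hne
    linear_combination h₁ - h₂
  linear_combination h₁ + (l ^ 2 - A - x₁ - x₂ - x₁) * key

theorem cubicPoints_double {A B C : ℤ} {x y : ℚ} (h : (x, y) ∈ cubicPoints A B C) (hy : y ≠ 0) :
    ∃ y', (((3 * x ^ 2 + 2 * A * x + B) / (2 * y)) ^ 2 - A - 2 * x, y') ∈ cubicPoints A B C := by
  simp only [cubicPoints, Set.mem_ofPred_eq] at h ⊢
  obtain ⟨l, hl⟩ : ∃ l, l = (3 * x ^ 2 + 2 * A * x + B) / (2 * y) := ⟨_, rfl⟩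
  have hl' : l * (2 * y) = 3 * x ^ 2 + 2 * A * x + B := by rw [hl]; field_simp
  rw [← hl]
  refine ⟨y + l * (l ^ 2 - A - 2 * x - x), ?_⟩
  linear_combination h + (l ^ 2 - A - 3 * x) * hl'

section TwoAdic

local instance : Fact (Nat.Prime 2) := ⟨Nat.prime_two⟩

theorem padicNorm_add_eq_left {x y : ℚ} (h : padicNorm 2 y < padicNorm 2 x) :
    padicNorm 2 (x + y) = padicNorm 2 x := by
  rw [padicNorm.add_eq_max_of_ne h.ne', max_eq_left h.le]

theorem padicNorm_int_mul_le (a : ℤ) (x : ℚ) : padicNorm 2 (a * x) ≤ padicNorm 2 x := by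
  rw [padicNorm.mul]
  exact mul_le_of_le_one_left (padicNorm.nonneg _) (padicNorm.of_int a)

theorem padicNorm_quadratic_le (a b c : ℤ) {x : ℚ} (hx : 1 < padicNorm 2 x) :
    padicNorm 2 (a * x ^ 2 + (b * x + c)) ≤ padicNorm 2 x ^ 2 := by
  have h1 : padicNorm 2 (a * x ^ 2) ≤ padicNorm 2 x ^ 2 :=
    (padicNorm_int_mul_le a (x ^ 2)).trans_eq (by rw [sq, padicNorm.mul, sq])
  have h2 : padicNorm 2 (b * x) ≤ padicNorm 2 x ^ 2 :=
    (padicNorm_int_mul_le b x).trans (by nlinarith)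
  have h3 : padicNorm 2 (c : ℚ) ≤ padicNorm 2 x ^ 2 := (padicNorm.of_int c).trans (by nlinarith)
  exact padicNorm.nonarchimedean.trans
    (max_le h1 (padicNorm.nonarchimedean.trans (max_le h2 h3)))

/-- Doubling a point whose abscissa has even denominator multiplies the `2`-adic norm of the
abscissa by `4`. -/
theorem exists_cubicPoints_padicNorm_gt {A B C : ℤ} {x y : ℚ} (h : (x, y) ∈ cubicPoints A B C)
    (hx : 1 < padicNorm 2 x) :
    y ≠ 0 ∧ ∃ P ∈ cubicPoints A B C, padicNorm 2 x < padicNorm 2 P.1 := by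
  have h0 : 0 < padicNorm 2 x := by linarith
  have hyy : padicNorm 2 y ^ 2 = padicNorm 2 x ^ 3 := by
    have e : y * y = x * x * x + (A * x ^ 2 + (B * x + C)) := by
      simp only [cubicPoints, Set.mem_ofPred_eq] at h
      linear_combination h
    have := congrArg (padicNorm 2) e
    rw [padicNorm_add_eq_left, padicNorm.mul, padicNorm.mul, padicNorm.mul] at this
    · linear_combination this
    · rw [padicNorm.mul, padicNorm.mul]
      refine (padicNorm_quadratic_le A B C hx).trans_lt ?_
      nlinarith [mul_pos h0 h0]
  have hy : y ≠ 0 := by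
    rintro rfl
    rw [padicNorm.zero] at hyy
    have := pow_pos h0 3
    norm_num at hyy
    linarith
  refine ⟨hy, ?_⟩
  obtain ⟨y', h'⟩ := cubicPoints_double h hy
  refine ⟨_, h', ?_⟩
  set x' := ((3 * x ^ 2 + 2 * A * x + B) / (2 * y)) ^ 2 - A - 2 * x with hx'
  -- the duplication formula, with denominator `4 * y ^ 2`
  have e : (4 : ℤ) * (y * y * x') = x * x * x * x +
      (((-2 * B : ℤ) : ℚ) * x ^ 2 + (((-8 * C : ℤ) : ℚ) * x + ((B ^ 2 - 4 * A * C : ℤ) : ℚ))) := by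
    have : x' * (4 * y ^ 2) = (3 * x ^ 2 + 2 * A * x + B) ^ 2 - (A + 2 * x) * (4 * y ^ 2) := by
      rw [hx']; field_simp; ring
    simp only [cubicPoints, Set.mem_ofPred_eq] at h
    push_cast
    linear_combination this - 4 * (A + 2 * x) * h
  have e4 : padicNorm 2 ((4 : ℤ) : ℚ) = 1 / 4 := by
    have : ((4 : ℤ) : ℚ) = ((2 : ℕ) : ℚ) * ((2 : ℕ) : ℚ) := by norm_num
    rw [this, padicNorm.mul, padicNorm.padicNorm_p (by norm_num)]
    norm_num
  have := congrArg (padicNorm 2) e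
  rw [padicNorm_add_eq_left, padicNorm.mul, padicNorm.mul, padicNorm.mul, padicNorm.mul,
    padicNorm.mul, padicNorm.mul, e4] at this
  · have h3 : 0 < padicNorm 2 x ^ 3 := pow_pos h0 3
    have : padicNorm 2 x ^ 3 * padicNorm 2 x' = padicNorm 2 x ^ 3 * (4 * padicNorm 2 x) := by
      rw [← hyy]
      nlinarith
    rw [mul_left_cancel₀ h3.ne' this]
    linarith
  · rw [padicNorm.mul, padicNorm.mul, padicNorm.mul]
    refine (padicNorm_quadratic_le _ _ _ hx).trans_lt ?_
    have := mul_pos h0 h0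
    nlinarith [mul_pos this h0]

theorem cubicPoints_infinite {A B C : ℤ} {x y : ℚ} (h : (x, y) ∈ cubicPoints A B C)
    (hx : 1 < padicNorm 2 x) : {P ∈ cubicPoints A B C | P.2 ≠ 0}.Infinite := by
  refine Set.Infinite.mono (s := {P ∈ cubicPoints A B C | 1 < padicNorm 2 P.1})
    (fun P hP => ⟨hP.1, (exists_cubicPoints_padicNorm_gt hP.1 hP.2).1⟩) fun hfin => ?_
  obtain ⟨P, hP, hmax⟩ := Set.exists_max_image _ (fun P : ℚ × ℚ => padicNorm 2 P.1) hfin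
    ⟨(x, y), h, hx⟩
  obtain ⟨Q, hQ, hlt⟩ := (exists_cubicPoints_padicNorm_gt hP.1 hP.2).2
  exact absurd (hmax Q ⟨hQ, hP.2.trans hlt⟩) (not_le.mpr hlt)

theorem one_lt_padicNorm_of_odd_of_even {x : ℚ} {u v : ℤ} (hu : Odd u) (hv : Even v)
    (h : x * v = u) : 1 < padicNorm 2 x := by
  have h1 : padicNorm 2 (u : ℚ) = 1 := by
    refine le_antisymm (padicNorm.of_int u) (not_lt.mp fun hlt => ?_)
    rw [padicNorm.int_lt_one_iff] at hlt
    exact (Int.not_even_iff_odd.mpr hu) (even_iff_two_dvd.mpr (by exact_mod_cast hlt))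
  have h2 : padicNorm 2 (v : ℚ) < 1 := by
    rw [padicNorm.int_lt_one_iff]
    exact_mod_cast even_iff_two_dvd.mp hv
  have h3 : padicNorm 2 x * padicNorm 2 (v : ℚ) = 1 := by rw [← padicNorm.mul, h, h1]
  by_contra hle
  push Not at hle
  nlinarith [padicNorm.nonneg (p := 2) x, padicNorm.nonneg (p := 2) (v : ℚ)]

end TwoAdic

/-! ### Accumulation of rational points -/

open Filter Topology in
/-- An infinite set of rational points on a nonsingular cubic yields rational points with
arbitrarily large abscissa. If the abscissae are bounded, the points accumulate at a real point.
When its ordinate is nonzero, the chord through one nearby point and the negative of another is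
almost vertical; when its ordinate is zero, the tangent at a nearby point is. -/
theorem exists_cubicPoints_gt {A B C : ℤ}
    (hsep : ∀ x : ℝ, x ^ 3 + A * x ^ 2 + B * x + C = 0 → 3 * x ^ 2 + 2 * A * x + B ≠ 0)
    (hinf : {P ∈ cubicPoints A B C | P.2 ≠ 0}.Infinite) (M : ℚ) :
    ∃ P ∈ cubicPoints A B C, M < P.1 := by
  by_contra hcon
  push Not at hcon
  let φ : ℚ × ℚ → ℝ × ℝ := fun P => (P.1, P.2)
  have hφ : Function.Injective φ := by
    rintro ⟨a, b⟩ ⟨c, d⟩ h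
    simp only [φ, Prod.mk.injEq, Rat.cast_inj] at h
    exact Prod.ext h.1 h.2
  set S : Set (ℝ × ℝ) := φ '' {P ∈ cubicPoints A B C | P.2 ≠ 0} with hS
  have hSinf : S.Infinite := hinf.image hφ.injOn
  let f : ℝ → ℝ := fun x => x ^ 3 + A * x ^ 2 + B * x + C
  have hfc : Continuous f := by fun_prop
  -- to the left of `-L` the cubic is negative
  let L : ℝ := 1 + |(A : ℝ)| + |(B : ℝ)| + |(C : ℝ)|
  have hlow : ∀ x, 0 ≤ f x → -L ≤ x := by
    intro x hx
    by_contra! hlt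
    have hA := neg_abs_le (A : ℝ)
    have hA' := le_abs_self (A : ℝ)
    have hB := neg_abs_le (B : ℝ)
    have hC' := le_abs_self (C : ℝ)
    have hx1 : 1 < -x := by
      have := abs_nonneg (A : ℝ); have := abs_nonneg (B : ℝ); have := abs_nonneg (C : ℝ)
      simp only [L] at hlt; linarith
    have e1 : (A : ℝ) * x ^ 2 ≤ |(A : ℝ)| * x ^ 2 := by gcongr
    have e2 : (B : ℝ) * x ≤ |(B : ℝ)| * x ^ 2 := by
      nlinarith [abs_nonneg (B : ℝ), mul_nonneg (abs_nonneg (B : ℝ)) (by nlinarith : 0 ≤ x ^ 2 + x)]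
    have e3 : (C : ℝ) ≤ |(C : ℝ)| * x ^ 2 := by
      nlinarith [abs_nonneg (C : ℝ),
        mul_nonneg (abs_nonneg (C : ℝ)) (by nlinarith : 0 ≤ x ^ 2 - 1)]
    have : f x ≤ x ^ 2 * (x + L - 1) := by simp only [f, L]; nlinarith
    have : x ^ 2 * (x + L - 1) < 0 := by
      apply mul_neg_of_pos_of_neg <;> nlinarith
    linarith
  have hmem : ∀ p ∈ S, p.2 ^ 2 = f p.1 ∧ p.1 ≤ M := by
    rintro _ ⟨P, hP, rfl⟩
    refine ⟨?_, by simpa [φ] using hcon P hP.1⟩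
    have := hP.1
    simp only [cubicPoints, Set.mem_ofPred_eq] at this
    simp only [φ, f]
    exact_mod_cast this
  obtain ⟨F, hF⟩ := (isCompact_Icc (a := -L) (b := (M : ℝ))).bddAbove_image hfc.continuousOn
  have hsub : S ⊆ Set.Icc (-L) (M : ℝ) ×ˢ Set.Icc (-(F + 1)) (F + 1) := by
    intro p hp
    obtain ⟨h1, h2⟩ := hmem p hp
    have hx : p.1 ∈ Set.Icc (-L) (M : ℝ) := ⟨hlow _ (h1 ▸ sq_nonneg _), h2⟩
    have h3 : p.2 ^ 2 ≤ F := h1 ▸ hF ⟨_, hx, rfl⟩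
    exact ⟨hx, by constructor <;> nlinarith⟩
  obtain ⟨⟨x₀, y₀⟩, -, hacc⟩ :=
    hSinf.exists_accPt_of_subset_isCompact (isCompact_Icc.prod isCompact_Icc) hsub
  rw [accPt_iff_nhds] at hacc
  have hclosed : IsClosed {p : ℝ × ℝ | p.2 ^ 2 = f p.1} :=
    isClosed_eq (by fun_prop) (hfc.comp continuous_fst)
  have h0 : y₀ ^ 2 = f x₀ := by
    have : (x₀, y₀) ∈ closure S := mem_closure_iff_nhds.mpr fun U hU => by
      obtain ⟨p, hp, -⟩ := hacc U hU
      exact ⟨p, hp⟩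
    exact closure_minimal (fun p hp => (hmem p hp).1) hclosed this
  by_cases hy₀ : y₀ = 0
  · subst hy₀
    have hd := hsep x₀ (by simpa [f] using h0.symm)
    -- `0 < N p` says that the double of `p` has abscissa greater than `M`
    let N : ℝ × ℝ → ℝ := fun p =>
      (3 * p.1 ^ 2 + 2 * A * p.1 + B) ^ 2 - (A + 2 * p.1 + M) * (2 * p.2) ^ 2
    have hN : Continuous N := by fun_prop
    have hpos : 0 < N (x₀, 0) := by
      have e : N (x₀, 0) = (3 * x₀ ^ 2 + 2 * A * x₀ + B) ^ 2 := by simp [N]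
      rw [e]
      exact sq_pos_of_ne_zero hd
    obtain ⟨_, ⟨hU, ⟨⟨x, y⟩, ⟨hP, hy⟩, rfl⟩⟩, -⟩ :=
      hacc {p | 0 < N p} ((isOpen_lt continuous_const hN).mem_nhds hpos)
    obtain ⟨y', h'⟩ := cubicPoints_double hP hy
    have hle := hcon _ h'
    simp only [N, φ, Set.mem_ofPred_eq] at hU
    have hU' : 0 < (3 * x ^ 2 + 2 * A * x + B) ^ 2 - (A + 2 * x + M) * (2 * y) ^ 2 := by
      exact_mod_cast hU
    have hy2 : 0 < (2 * y) ^ 2 := by positivity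
    have : (A + 2 * x + M) < ((3 * x ^ 2 + 2 * A * x + B) / (2 * y)) ^ 2 := by
      rw [div_pow, lt_div_iff₀ hy2]
      linarith
    linarith
  · -- `0 < N (p, r)` says that the difference of `p` and `r` has abscissa greater than `M`
    let N : (ℝ × ℝ) × (ℝ × ℝ) → ℝ := fun p =>
      (p.1.2 + p.2.2) ^ 2 - (A + p.1.1 + p.2.1 + M) * (p.1.1 - p.2.1) ^ 2
    have hN : Continuous N := by fun_prop
    have hpos : 0 < N ((x₀, y₀), (x₀, y₀)) := by
      simp only [N, sub_self]
      have : 0 < (y₀ + y₀) ^ 2 := by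
        apply sq_pos_of_ne_zero
        intro h
        exact hy₀ (by linarith)
      nlinarith
    have hpos' : 0 < (y₀ * y₀) := mul_self_pos.mpr hy₀
    have hV : ∀ᶠ p : (ℝ × ℝ) × (ℝ × ℝ) in 𝓝 ((x₀, y₀), (x₀, y₀)),
        0 < N p ∧ 0 < p.1.2 * p.2.2 :=
      (continuous_const.tendsto _ |>.eventually_lt (hN.tendsto _) hpos).and
        (continuous_const.tendsto _ |>.eventually_lt
          (Continuous.tendsto (by fun_prop : Continuous
            fun p : (ℝ × ℝ) × (ℝ × ℝ) => p.1.2 * p.2.2) _) hpos')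
    rw [nhds_prod_eq] at hV
    obtain ⟨U, hU, hUV⟩ := (eventually_prod_self_iff
      (r := fun p r => 0 < N (p, r) ∧ 0 < p.2 * r.2)).mp hV
    obtain ⟨p, ⟨hpU, hpS⟩, hpne⟩ := hacc U hU
    -- a second nearby point, distinct from the first
    obtain ⟨r, ⟨⟨hrU, hrp⟩, hrS⟩, -⟩ :=
      hacc (U ∩ {p}ᶜ) (inter_mem hU (isOpen_compl_singleton.mem_nhds (Ne.symm hpne)))
    obtain ⟨hNpos, hsign⟩ := hUV p hpU r hrU
    obtain ⟨⟨x₁, y₁⟩, ⟨h₁, -⟩, rfl⟩ := hpS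
    obtain ⟨⟨x₂, y₂⟩, ⟨h₂, -⟩, rfl⟩ := hrS
    simp only [N, φ] at hNpos hsign
    have hsign' : 0 < y₁ * y₂ := by exact_mod_cast hsign
    have hNpos' : 0 < (y₁ + y₂) ^ 2 - (A + x₁ + x₂ + M) * (x₁ - x₂) ^ 2 := by
      exact_mod_cast hNpos
    have hx : x₁ ≠ x₂ := by
      rintro rfl
      have h3 : y₁ ^ 2 = y₂ ^ 2 := by
        simp only [cubicPoints, Set.mem_ofPred_eq] at h₁ h₂
        rw [h₁, h₂]
      rcases sq_eq_sq_iff_eq_or_eq_neg.mp h3 with rfl | rfl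
      · exact hrp rfl
      · nlinarith
    obtain ⟨y', h'⟩ := cubicPoints_chord h₁ h₂ hx
    have hle := hcon _ h'
    have hx2 : 0 < (x₁ - x₂) ^ 2 := by
      have := sub_ne_zero.mpr hx
      positivity
    have : A + x₁ + x₂ + M < ((y₁ + y₂) / (x₁ - x₂)) ^ 2 := by
      rw [div_pow, lt_div_iff₀ hx2]
      linarith
    linarith

/-- Rational points of the quartic `v ^ 2 = a * z ^ 4 + b * z ^ 3 + c * z ^ 2 + d * z + q ^ 2`
accumulate at `(0, q)` as soon as the resolvent cubic has rational points of arbitrarily large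
abscissa: substituting `v = q + d / (2 * q) * z - x / (2 * q) * z ^ 2` leaves a quadratic equation
for `z` whose discriminant is a square exactly when `x` is the abscissa of a rational point of the
cubic, and `z` tends to `0` as `x` grows. -/
theorem exists_quartic_point_near_zero {a b c d q : ℤ} (hq : q ≠ 0)
    (hlarge : ∀ M : ℚ, ∃ P ∈ cubicPoints c (b * d - 4 * a * q ^ 2)
      (b ^ 2 * q ^ 2 + a * d ^ 2 - 4 * a * q ^ 2 * c), M < P.1) {ε : ℚ} (hε : 0 < ε) :
    ∃ z v : ℚ, v ^ 2 = a * z ^ 4 + b * z ^ 3 + c * z ^ 2 + d * z + q ^ 2 ∧ z ≠ 0 ∧ |z| < ε := by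
  have hq' : (q : ℚ) ≠ 0 := by exact_mod_cast hq
  have hq2 : (0 : ℚ) < q ^ 2 := by positivity
  set E : ℚ := 4 * a * q ^ 2 with hE
  set β : ℚ := b * d - 4 * a * q ^ 2 with hβ
  set γ : ℚ := b ^ 2 * q ^ 2 + a * d ^ 2 - 4 * a * q ^ 2 * c with hγ
  set K : ℚ := |(d : ℚ)| + |2 * q ^ 2 * (b : ℚ)| with hK
  have hK0 : 0 ≤ K := by positivity
  set R : ℚ := 8 * (K ^ 2 + 16 * q ^ 2) with hR
  obtain ⟨⟨x, y⟩, hP, hx⟩ := hlarge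
    (1 + |(c : ℚ)| + |β| + |γ| + 2 * |E| + R / ε ^ 2 + (d : ℚ) ^ 2 / (4 * q ^ 2))
  simp only [cubicPoints, Set.mem_ofPred_eq] at hP
  push_cast at hP
  rw [← hβ, ← hγ] at hP
  simp only at hx
  have n1 := abs_nonneg (c : ℚ)
  have n2 := abs_nonneg β
  have n3 := abs_nonneg γ
  have n4 := abs_nonneg E
  have n5 : 0 ≤ R / ε ^ 2 := by positivity
  have n6 : 0 ≤ (d : ℚ) ^ 2 / (4 * q ^ 2) := by positivity
  have hx1 : 1 < x := by linarith
  have hden : x ^ 2 / 2 ≤ x ^ 2 - E := by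
    have : 2 * |E| ≤ x := by linarith
    have : x ≤ x ^ 2 := by nlinarith
    linarith [le_abs_self E]
  have hxx : 0 < x ^ 2 := by positivity
  have hden0 : 0 < x ^ 2 - E := by linarith
  have hy2 : y ^ 2 ≤ 4 * x ^ 3 := by
    rw [hP]
    have e1 : (c : ℚ) * x ^ 2 ≤ x * x ^ 2 := by
      have := le_abs_self (c : ℚ); gcongr; linarith
    have e2 : β * x ≤ x ^ 2 * x := by
      have := le_abs_self β
      have : x ≤ x ^ 2 := by nlinarith
      gcongr
      linarith
    have e3 : γ ≤ x ^ 3 :=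
      le_trans (by linarith [le_abs_self γ]) (le_self_pow₀ hx1.le (by norm_num))
    linarith
  set l : ℚ := d * x + 2 * q ^ 2 * b with hl
  have hl2 : |l| ≤ K * x := by
    rw [hl, hK, add_mul]
    refine (abs_add_le _ _).trans ?_
    rw [abs_mul, abs_of_pos (by linarith : 0 < x)]
    have : |2 * q ^ 2 * (b : ℚ)| ≤ |2 * q ^ 2 * (b : ℚ)| * x :=
      le_mul_of_one_le_right (abs_nonneg _) hx1.le
    linarith
  have hl3 : l ^ 2 ≤ K ^ 2 * x ^ 3 := by
    calc l ^ 2 = |l| ^ 2 := (sq_abs l).symm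
      _ ≤ (K * x) ^ 2 := by gcongr
      _ = K ^ 2 * x ^ 2 := by ring
      _ ≤ K ^ 2 * x ^ 3 := by gcongr <;> linarith
  set z : ℚ := (l + 2 * q * y) / (x ^ 2 - E) with hz
  have hz' : z * (x ^ 2 - E) = l + 2 * q * y := by rw [hz]; field_simp
  have hquad : (x ^ 2 - E) * z ^ 2 - 2 * l * z = 4 * q ^ 2 * (x + c) - d ^ 2 := by
    apply mul_left_cancel₀ hden0.ne'
    have : (z * (x ^ 2 - E) - l) ^ 2 = 4 * q ^ 2 * y ^ 2 := by rw [hz']; ring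
    rw [hP] at this
    linear_combination this
  refine ⟨z, q + d / (2 * q) * z - x / (2 * q) * z ^ 2, ?_, ?_, ?_⟩
  · field_simp
    linear_combination z ^ 2 * hquad
  · rintro h
    rw [h] at hquad
    have : (d : ℚ) ^ 2 / (4 * q ^ 2) < x + c := by
      linarith [neg_abs_le (c : ℚ)]
    rw [div_lt_iff₀ (by positivity)] at this
    linarith
  · apply abs_lt_of_sq_lt_sq _ hε.le
    have e1 : (l + 2 * q * y) ^ 2 ≤ 2 * (K ^ 2 + 16 * q ^ 2) * x ^ 3 := by
      calc (l + 2 * q * y) ^ 2 ≤ 2 * (l ^ 2 + (2 * q * y) ^ 2) := add_sq_le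
        _ = 2 * (l ^ 2 + 4 * (q ^ 2 * y ^ 2)) := by ring
        _ ≤ 2 * (K ^ 2 * x ^ 3 + 4 * (q ^ 2 * (4 * x ^ 3))) := by gcongr
        _ = 2 * (K ^ 2 + 16 * q ^ 2) * x ^ 3 := by ring
    have e2 : z ^ 2 * (x ^ 2 / 2) ^ 2 ≤ 2 * (K ^ 2 + 16 * q ^ 2) * x ^ 3 := by
      refine le_trans ?_ e1
      rw [← hz', mul_pow]
      gcongr
    have hxp : 0 < x ^ 3 := by positivity
    have e3 : z ^ 2 * x ≤ R := by
      refine le_of_mul_le_mul_right ?_ hxp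
      rw [hR]
      linarith
    have e4 : R < ε ^ 2 * x := by
      have : R / ε ^ 2 < x := by linarith [neg_abs_le (c : ℚ)]
      rw [div_lt_iff₀ (by positivity)] at this
      linarith
    exact lt_of_mul_lt_mul_right (e3.trans_lt e4) (by linarith)

/-! ### From the fibre equation to nontrivial solutions -/

theorem sum_ne_zero_of_fin_four {t : Fin 4 → ℤ} (hsum : t 0 + t 1 + t 2 + t 3 = 0)
    (h0 : t 0 ≠ 0) (h1 : t 1 ≠ 0) (h2 : t 2 ≠ 0) (h3 : t 3 ≠ 0)
    (h01 : t 0 + t 1 ≠ 0) (h02 : t 0 + t 2 ≠ 0) (h03 : t 0 + t 3 ≠ 0) (S : Finset (Fin 4))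
    (hne : S.Nonempty) (huniv : S ≠ Finset.univ) : ∑ i ∈ S, t i ≠ 0 := by
  have e : ∑ i ∈ S, t i = ∑ i, if i ∈ S then t i else 0 := by
    rw [← Finset.sum_filter, Finset.filter_mem_eq_inter, Finset.univ_inter]
  have hne' : 0 ∈ S ∨ 1 ∈ S ∨ 2 ∈ S ∨ 3 ∈ S := by
    obtain ⟨i, hi⟩ := hne
    fin_cases i <;> simp_all
  have huniv' : 0 ∉ S ∨ 1 ∉ S ∨ 2 ∉ S ∨ 3 ∉ S := by
    by_contra! h
    exact huniv (Finset.eq_univ_iff_forall.mpr fun i => by fin_cases i <;> simp_all)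
  rw [e, Fin.sum_univ_four]
  split_ifs <;> first | omega | simp_all

theorem fourth_power_young (n r : ℚ) : 4 * (n * r ^ 3) ≤ n ^ 4 + 3 * r ^ 4 := by
  nlinarith [mul_nonneg (sq_nonneg (n - r)) (by positivity : 0 ≤ (n + r) ^ 2 + 2 * r ^ 2)]

/-- The equality case of `fourth_power_young`. -/
theorem eq_of_fourth_power_young {n r : ℚ} (h : n ^ 4 + 3 * r ^ 4 = 4 * (n * r ^ 3)) : n = r := by
  have : (n - r) ^ 2 * ((n + r) ^ 2 + 2 * r ^ 2) = 0 := by linear_combination h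
  rcases mul_eq_zero.mp this with h' | h'
  · exact sub_eq_zero.mp (pow_eq_zero_iff two_ne_zero |>.mp h')
  · have hr : r = 0 := by nlinarith [sq_nonneg (n + r), sq_nonneg r]
    subst hr
    simpa using h'

/-- If `x = r ^ 4`, `a = r ^ 3` and `y = t ^ 4`, `b = t ^ 3`, then `n * a - m * b = x + y` is the
equality case of Young's inequality, which forces `r = n` and `t = -m`. -/
theorem eq_cube_of_cubes_eq_fourth_powers {x y a b m n : ℤ} (hx : 0 < x) (hy : 0 < y)
    (hs : x + y = m ^ 4 + n ^ 4) (hab : n * a - m * b = m ^ 4 + n ^ 4) (hxa : x ^ 3 = a ^ 4)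
    (hyb : y ^ 3 = b ^ 4) : a = n ^ 3 ∧ b = (-m) ^ 3 := by
  have root : ∀ {x a : ℤ}, 0 < x → x ^ 3 = a ^ 4 → ∃ r : ℚ, r ^ 3 = a ∧ r ^ 4 = x := by
    intro x a hx h
    have ha : (a : ℚ) ≠ 0 := by
      rintro h0
      rw [Int.cast_eq_zero] at h0
      subst h0
      have := pow_pos hx 3
      simp_all
    have h' : (x : ℚ) ^ 3 = a ^ 4 := by exact_mod_cast h
    -- a number with cube `a` and fourth power `x` has to be their quotient
    refine ⟨x / a, ?_, ?_⟩
    · field_simp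
      linear_combination h'
    · field_simp
      linear_combination h'
  obtain ⟨r, hr3, hr4⟩ := root hx hxa
  obtain ⟨t, ht3, ht4⟩ := root hy hyb
  have hs' : r ^ 4 + t ^ 4 = (m : ℚ) ^ 4 + n ^ 4 := by rw [hr4, ht4]; exact_mod_cast hs
  have hab' : n * r ^ 3 + (-m) * t ^ 3 = (m : ℚ) ^ 4 + n ^ 4 := by
    rw [hr3, ht3, neg_mul, ← sub_eq_add_neg]; exact_mod_cast hab
  have y1 := fourth_power_young n r
  have y2 := fourth_power_young (-m) t
  have e4 : (-(m : ℚ)) ^ 4 = m ^ 4 := by ring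
  have e1 : (n : ℚ) = r := eq_of_fourth_power_young (by linarith)
  have e2 : (-m : ℚ) = t := eq_of_fourth_power_young (by linarith)
  rw [← e1] at hr3
  rw [← e2] at ht3
  exact ⟨by exact_mod_cast hr3.symm, by exact_mod_cast ht3.symm⟩

/-- The equation in `m`, `n`, `f`, `d` which says that, whenever `x + y = m ^ 4 + n ^ 4`,
`x - y = d`, `a = m * f + n ^ 3` and `b = n * f - m ^ 3`, then `x ^ 3 + y ^ 3 = a ^ 4 + b ^ 4`. -/
def IsFibrePoint (m n f d : ℤ) : Prop :=
  3 * d ^ 2 = 4 * f ^ 4 + 24 * m ^ 2 * n ^ 2 * f ^ 2 - 16 * m * n * (m ^ 4 - n ^ 4) * f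
    + 3 * (m ^ 4 - n ^ 4) ^ 2

namespace IsFibrePoint

variable {m n f d : ℤ}

theorem add_cubes (h : IsFibrePoint m n f d) {x y : ℤ} (hadd : x + y = m ^ 4 + n ^ 4)
    (hsub : x - y = d) : x ^ 3 + y ^ 3 = (m * f + n ^ 3) ^ 4 + (n * f - m ^ 3) ^ 4 := by
  unfold IsFibrePoint at h
  have e : 4 * (x ^ 3 + y ^ 3) = (x + y) * ((x + y) ^ 2 + 3 * (x - y) ^ 2) := by ring
  rw [hadd, hsub] at e
  have : 4 * (x ^ 3 + y ^ 3) = 4 * ((m * f + n ^ 3) ^ 4 + (n * f - m ^ 3) ^ 4) := by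
    linear_combination e + (m ^ 4 + n ^ 4) * h
  linarith

theorem abs (h : IsFibrePoint m n f d) : IsFibrePoint m n f |d| := by
  unfold IsFibrePoint at h ⊢
  rwa [sq_abs]

theorem exists_add_sub (h : IsFibrePoint m n f d) :
    ∃ x y : ℤ, x + y = m ^ 4 + n ^ 4 ∧ x - y = d := by
  unfold IsFibrePoint at h
  have hpar : Even (d + (m ^ 4 + n ^ 4)) := by
    have h1 : Even (3 * d ^ 2) ↔ Even (3 * (m ^ 4 - n ^ 4) ^ 2) := by
      rw [h]
      have : Even (4 * f ^ 4 + 24 * m ^ 2 * n ^ 2 * f ^ 2 - 16 * m * n * (m ^ 4 - n ^ 4) * f) :=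
        ⟨2 * f ^ 4 + 12 * m ^ 2 * n ^ 2 * f ^ 2 - 8 * m * n * (m ^ 4 - n ^ 4) * f, by ring⟩
      simp only [Int.even_add, this, true_iff]
    have h2 : ¬ Even (3 : ℤ) := by decide
    rw [Int.even_mul, Int.even_mul, Int.even_pow' two_ne_zero, Int.even_pow' two_ne_zero] at h1
    rw [Int.even_add, Int.even_add]
    rw [Int.even_sub] at h1
    tauto
  obtain ⟨x, hx⟩ := hpar
  exact ⟨x, m ^ 4 + n ^ 4 - x, by ring, by linarith⟩

/-- If `a = m * f + n ^ 3` vanished, coprimality would give `b = n * f - m ^ 3 = ±1`, contradicting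
`n * a - m * b = m ^ 4 + n ^ 4`. -/
theorem left_ne_zero (hm : m ≠ 0) (hn : n ≠ 0)
    (hgcd : Int.gcd (m * f + n ^ 3) (n * f - m ^ 3) = 1) : m * f + n ^ 3 ≠ 0 := by
  intro h
  have hs : n * (m * f + n ^ 3) - m * (n * f - m ^ 3) = m ^ 4 + n ^ 4 := by ring
  rw [h, Int.gcd_zero_left] at hgcd
  rw [h] at hs
  have h1 : -(m * (n * f - m ^ 3)) ≤ |m| := by
    rw [← mul_neg]
    rcases Int.natAbs_eq_iff.mp hgcd with e | e <;> rw [e] <;>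
      simp [le_abs_self, neg_le_abs]
  have h2 : |m| ≤ m ^ 4 := by
    rw [← (by decide : Even 4).pow_abs]
    exact le_self_pow₀ (Int.one_le_abs hm) (by norm_num)
  have h3 : 0 < n ^ 4 := by positivity
  linarith

theorem right_ne_zero (hm : m ≠ 0) (hn : n ≠ 0)
    (hgcd : Int.gcd (m * f + n ^ 3) (n * f - m ^ 3) = 1) : n * f - m ^ 3 ≠ 0 := by
  have e1 : n * f + (-m) ^ 3 = n * f - m ^ 3 := by ring
  have e2 : n * f - m ^ 3 ≠ 0 ↔ n * f + (-m) ^ 3 ≠ 0 := by rw [e1]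
  rw [e2]
  refine left_ne_zero hn (neg_ne_zero.mpr hm) ?_
  have e3 : -m * f - n ^ 3 = -(m * f + n ^ 3) := by ring
  rw [e1, e3, Int.gcd_neg, Int.gcd_comm, hgcd]

/-- The solution for the sign `+`. The hypothesis `f ≠ 0` excludes the trivial solutions
`m ^ 12 + n ^ 12 = n ^ 12 + m ^ 12`. -/
theorem exists_nontrivial_add (h : IsFibrePoint m n f d) (hm : m ≠ 0) (hn : n ≠ 0) (hf : f ≠ 0)
    (hgcd : Int.gcd (m * f + n ^ 3) (n * f - m ^ 3) = 1) (hlt : |d| < m ^ 4 + n ^ 4) :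
    ∃ x y a b : ℤ, 0 < x ∧ 0 < y ∧ 0 < a ∧ 0 < b ∧ IsNontrivialSolution 4 1 1 x y a b ∧
      x + y = m ^ 4 + n ^ 4 := by
  obtain ⟨x, y, hadd, hsub⟩ := h.exists_add_sub
  have heq := h.add_cubes hadd hsub
  have ha := left_ne_zero hm hn hgcd
  have hb := right_ne_zero hm hn hgcd
  have hlin : n * (m * f + n ^ 3) - m * (n * f - m ^ 3) = m ^ 4 + n ^ 4 := by ring
  have htriv : ¬ (m * f + n ^ 3 = n ^ 3 ∧ n * f - m ^ 3 = (-m) ^ 3) := by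
    rintro ⟨e, -⟩
    exact mul_ne_zero hm hf (by linarith)
  set a := m * f + n ^ 3
  set b := n * f - m ^ 3
  obtain ⟨h1, h2⟩ := abs_lt.mp hlt
  have hx : 0 < x := by linarith
  have hy : 0 < y := by linarith
  have ha4 : |a| ^ 4 = a ^ 4 := (by decide : Even 4).pow_abs a
  have hb4 : |b| ^ 4 = b ^ 4 := (by decide : Even 4).pow_abs b
  have hx3 := pow_pos hx 3
  have hy3 := pow_pos hy 3
  have ha4' : 0 < a ^ 4 := by positivity
  have hb4' : 0 < b ^ 4 := by positivity
  refine ⟨x, y, |a|, |b|, hx, hy, abs_pos.mpr ha, abs_pos.mpr hb, ⟨?_, ?_, ?_⟩, hadd⟩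
  · simp only [Units.val_one, one_mul, ha4, hb4]
    exact heq
  · have hgcd' : Int.gcd |a| |b| = 1 := by
      rw [← hgcd, Int.gcd, Int.natAbs_abs, Int.natAbs_abs, Int.gcd]
    rw [hgcd', Nat.gcd_one_right]
  · apply sum_ne_zero_of_fin_four <;>
      simp [signedTerms, ha4, hb4, -abs_pow, hx.ne', hy.ne', ha, hb]
    · linarith
    · linarith
    · intro h0
      exact htriv (eq_cube_of_cubes_eq_fourth_powers hx hy hadd hlin (by linarith) (by linarith))
    · intro h0
      exact htriv (eq_cube_of_cubes_eq_fourth_powers hy hx (by linarith) hlin (by linarith)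
        (by linarith))

/-- The solution for the sign `-`. Here `x ^ 3 = y ^ 3 + a ^ 4 + b ^ 4` with all terms positive, so no
partial sum vanishes, whatever `f` is. -/
theorem exists_nontrivial_sub (h : IsFibrePoint m n f d) (hm : m ≠ 0) (hn : n ≠ 0)
    (hgcd : Int.gcd (m * f + n ^ 3) (n * f - m ^ 3) = 1) (hlt : m ^ 4 + n ^ 4 < |d|) :
    ∃ x y a b : ℤ, 0 < x ∧ 0 < y ∧ 0 < a ∧ 0 < b ∧ IsNontrivialSolution 4 (-1) 1 x y a b ∧
      x - y = m ^ 4 + n ^ 4 := by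
  obtain ⟨x, y', hadd, hsub⟩ := h.abs.exists_add_sub
  have heq := h.abs.add_cubes hadd hsub
  obtain ⟨y, rfl⟩ : ∃ y, y' = -y := ⟨-y', by ring⟩
  have ha := left_ne_zero hm hn hgcd
  have hb := right_ne_zero hm hn hgcd
  set a := m * f + n ^ 3
  set b := n * f - m ^ 3
  have hs : 0 < m ^ 4 + n ^ 4 := by positivity
  have hx : 0 < x := by linarith
  have hy : 0 < y := by linarith
  have ha4 : |a| ^ 4 = a ^ 4 := (by decide : Even 4).pow_abs a
  have hb4 : |b| ^ 4 = b ^ 4 := (by decide : Even 4).pow_abs b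
  have hx3 := pow_pos hx 3
  have hy3 := pow_pos hy 3
  have ha4' : 0 < a ^ 4 := by positivity
  have hb4' : 0 < b ^ 4 := by positivity
  have heq' : x ^ 3 - y ^ 3 = a ^ 4 + b ^ 4 := by linear_combination heq
  refine ⟨x, y, |a|, |b|, hx, hy, abs_pos.mpr ha, abs_pos.mpr hb, ⟨?_, ?_, ?_⟩, by linarith⟩
  · simp only [Units.val_one, one_mul, ha4, hb4, Units.val_neg]
    linarith
  · have hgcd' : Int.gcd |a| |b| = 1 := by
      rw [← hgcd, Int.gcd, Int.natAbs_abs, Int.natAbs_abs, Int.gcd]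
    rw [hgcd', Nat.gcd_one_right]
  · apply sum_ne_zero_of_fin_four <;>
      simp [signedTerms, ha4, hb4, -abs_pow, hx.ne', hy.ne', ha, hb]
    all_goals linarith

end IsFibrePoint

/-! ### Coprimality and integrality -/

/-- With `f = (p / q) * (m ^ 2 - n ^ 2)`, a prime dividing both `m * f + n ^ 3` and
`n * f - m ^ 3` divides `m ^ 4 + n ^ 4` and `2 * p ^ 2 - q ^ 2`. -/
theorem IsFibrePoint.gcd_eq_one {m n f p q : ℤ} (hmn : IsCoprime m n)
    (hk : q * f = p * (m ^ 2 - n ^ 2)) (hf : Even f)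
    (hpq : ∀ r : ℤ, Prime r → r ∣ 2 * p ^ 2 - q ^ 2 → r ∣ m ^ 4 + n ^ 4 → r ∣ n) :
    Int.gcd (m * f + n ^ 3) (n * f - m ^ 3) = 1 := by
  by_contra hne
  obtain ⟨r', hr', hdvd⟩ := Nat.exists_prime_and_dvd hne
  obtain ⟨r, hr⟩ : ∃ r : ℤ, r = r' := ⟨_, rfl⟩
  have hprime : Prime r := hr ▸ Nat.prime_iff_prime_int.mp hr'
  have hdvd' : r ∣ (Int.gcd (m * f + n ^ 3) (n * f - m ^ 3) : ℤ) := by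
    rw [hr]; exact_mod_cast hdvd
  have ha : r ∣ m * f + n ^ 3 := hdvd'.trans (Int.gcd_dvd_left ..)
  have hb : r ∣ n * f - m ^ 3 := hdvd'.trans (Int.gcd_dvd_right ..)
  have hs : r ∣ m ^ 4 + n ^ 4 := by
    have := dvd_sub (ha.mul_left n) (hb.mul_left m)
    ring_nf at this ⊢
    exact this
  have hn : ¬ r ∣ n := by
    intro h
    have h4 : r ∣ m ^ 4 := (dvd_add_left (h.trans (dvd_pow_self n four_ne_zero))).mp hs
    exact hprime.not_isUnit (hmn.isUnit_of_dvd' (hprime.dvd_of_dvd_pow h4) h)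
  have hm : ¬ r ∣ m := by
    intro h
    have h4 : r ∣ n ^ 4 := (dvd_add_right (h.trans (dvd_pow_self m four_ne_zero))).mp hs
    exact hn (hprime.dvd_of_dvd_pow h4)
  have h2 : ¬ r ∣ 2 := by
    intro h
    have hrf : r ∣ f := h.trans hf.two_dvd
    exact hn (hprime.dvd_of_dvd_pow ((dvd_add_right (hrf.mul_left m)).mp ha))
  -- eliminate `f` from `m * a + n * b`
  have hprod : r ∣ (m ^ 2 - n ^ 2) * (p * (m ^ 2 + n ^ 2) - q * (m * n)) := by
    have e : (m ^ 2 - n ^ 2) * (p * (m ^ 2 + n ^ 2) - q * (m * n)) =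
        q * (m * (m * f + n ^ 3) + n * (n * f - m ^ 3)) := by
      linear_combination (-(m ^ 2 + n ^ 2)) * hk
    rw [e]
    exact (dvd_add (ha.mul_left m) (hb.mul_left n)).mul_left q
  rcases hprime.dvd_or_dvd hprod with h | h
  · have : r ∣ 2 * n ^ 4 := by
      have := dvd_sub hs (h.mul_right (m ^ 2 + n ^ 2))
      ring_nf at this ⊢
      exact this
    rcases hprime.dvd_or_dvd this with h' | h'
    · exact h2 h'
    · exact hn (hprime.dvd_of_dvd_pow h')
  · have : r ∣ (2 * p ^ 2 - q ^ 2) * (m * n) ^ 2 := by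
      have := dvd_sub (h.mul_right (p * (m ^ 2 + n ^ 2) + q * (m * n))) (hs.mul_left (p ^ 2))
      ring_nf at this ⊢
      exact this
    rcases hprime.dvd_or_dvd this with h' | h'
    · exact hn (hpq r hprime h' hs)
    · rcases hprime.dvd_or_dvd (hprime.dvd_of_dvd_pow h') with h' | h'
      · exact hm h'
      · exact hn h'

/-- A rational number `x` is an integer as soon as `3 * x ^ 2` is one, because `3` is squarefree. -/
theorem exists_int_of_three_mul_sq {x : ℚ} {R : ℤ} (h : 3 * x ^ 2 = R) :
    ∃ d : ℤ, x ^ 2 = d ^ 2 ∧ 3 * d ^ 2 = R := by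
  have hsq : IsSquare ((3 * R : ℤ) : ℚ) := ⟨3 * x, by push_cast; linear_combination (-3) * h⟩
  rw [Rat.isSquare_intCast_iff] at hsq
  obtain ⟨w, hw⟩ := hsq
  have h3 : (3 : ℤ) ∣ w := Int.prime_three.dvd_of_dvd_pow (n := 2) ⟨R, by linarith⟩
  obtain ⟨d, rfl⟩ := h3
  have hd : 3 * d ^ 2 = R := by linarith
  refine ⟨d, ?_, hd⟩
  rw [← hd] at h
  push_cast at h
  linarith

/-- The curve obtained from `IsFibrePoint` by putting `f = k * (m ^ 2 - n ^ 2)`, in the coordinates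
`t = m / n` and `w = d / ((t ^ 2 - 1) * n ^ 4)`. -/
def IsCurvePoint (k t w : ℚ) : Prop :=
  3 * w ^ 2 = 4 * k ^ 4 * (t ^ 2 - 1) ^ 2 + 24 * k ^ 2 * t ^ 2 - 16 * k * t * (t ^ 2 + 1)
    + 3 * (t ^ 2 + 1) ^ 2

/-- A rational point with `f` integral gives an integral solution of `IsFibrePoint`; only the square
of `d` is prescribed, its sign being irrelevant. -/
theorem IsCurvePoint.exists_isFibrePoint {k t w : ℚ} (h : IsCurvePoint k t w) {f : ℤ}
    (hf : (f : ℚ) = k * (t.num ^ 2 - t.den ^ 2)) :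
    ∃ d : ℤ, IsFibrePoint t.num t.den f d ∧ (d : ℚ) ^ 2 = (t.den ^ 4 * ((t ^ 2 - 1) * w)) ^ 2 := by
  have hn : (t.den : ℚ) ≠ 0 := by exact_mod_cast t.den_nz
  have ht : (t.num : ℚ) = t * t.den := (Rat.mul_den_eq_num t).symm
  unfold IsCurvePoint at h
  obtain ⟨d, hd, hd'⟩ := exists_int_of_three_mul_sq (x := t.den ^ 4 * ((t ^ 2 - 1) * w))
    (R := 4 * f ^ 4 + 24 * t.num ^ 2 * t.den ^ 2 * f ^ 2
      - 16 * t.num * t.den * (t.num ^ 4 - t.den ^ 4) * f + 3 * (t.num ^ 4 - t.den ^ 4) ^ 2) (by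
    push_cast
    rw [hf, ht]
    linear_combination t.den ^ 8 * (t ^ 2 - 1) ^ 2 * h)
  exact ⟨d, hd', hd.symm⟩

theorem fourth_powers_twenty_three : ∀ m n : ZMod 23, m ^ 4 + n ^ 4 = 0 → n = 0 := by decide

theorem fourth_powers_seventy_one : ∀ m n : ZMod 71, m ^ 4 + n ^ 4 = 0 → n = 0 := by
  set_option maxRecDepth 100000 in decide

theorem dvd_of_dvd_fourth_powers {l : ℕ} (hl : l.Prime)
    (h : ∀ m n : ZMod l, m ^ 4 + n ^ 4 = 0 → n = 0) {m n r : ℤ} (hr : Prime r) (hrl : r ∣ l)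
    (hmn : r ∣ m ^ 4 + n ^ 4) : r ∣ n := by
  have hlr : (l : ℤ) ∣ r := ((hr.associated_of_dvd (Nat.prime_iff_prime_int.mp hl) hrl).symm).dvd
  have h1 := (ZMod.intCast_zmod_eq_zero_iff_dvd _ l).mpr (hlr.trans hmn)
  push_cast at h1
  exact hrl.trans ((ZMod.intCast_zmod_eq_zero_iff_dvd _ l).mp (h _ _ h1))

/-! ### The two curves -/

/-- The quartic model of the curve for `k = 4 / 3` in the coordinate `u` with
`t = (1 + u) / (1 - u)`. -/
theorem quartic_points_near_one {ε : ℚ} (hε : 0 < ε) :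
    ∃ u v : ℚ, v ^ 2 = 5913 * u ^ 4 + 8562 * u ^ 2 + 729 ∧ u ≠ 0 ∧ |u| < ε := by
  -- the point is four times `(60750, 15956352)`
  have hinf := cubicPoints_infinite (A := 8562) (B := -17242308) (C := -147628641096)
    (x := 176188189965030438119428545412513 / 42236190983081951262319928976)
    (y := -390679037080121952387871103168432377369340043905 /
      8680147747440946627398704181926539652476224)
    (by simp only [cubicPoints, Set.mem_ofPred_eq]; norm_num)
    (one_lt_padicNorm_of_odd_of_even (u := 176188189965030438119428545412513)
      (v := 42236190983081951262319928976) (by decide) (by decide) (by norm_num))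
  have hlarge := exists_cubicPoints_gt (fun x hx => ?_) hinf
  · obtain ⟨u, v, h, hu⟩ := exists_quartic_point_near_zero (a := 5913) (b := 0) (c := 8562)
      (d := 0) (q := 27) (by norm_num) (by convert hlarge using 6 <;> norm_num) hε
    refine ⟨u, v, ?_, hu⟩
    rw [h]; push_cast; ring
  · have hx' : (x + 8562) * (x ^ 2 - 17242308) = 0 := by push_cast at hx; linear_combination hx
    push_cast
    rcases mul_eq_zero.mp hx' with h | h <;> intro h'
    · obtain rfl : x = -8562 := by linarith
      norm_num at h'
    · nlinarith

/-- The quartic model of the curve for `k = 6` in the coordinate `z` with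
`t = -(3 + z) / (1 + 3 * z)`. -/
theorem quartic_points_near_neg_three {ε : ℚ} (hε : 0 < ε) :
    ∃ z v : ℚ, v ^ 2 = 28561 * z ^ 4 + 5468 * z ^ 3 - 45274 * z ^ 2 + 5468 * z + 28561 ∧
      z ≠ 0 ∧ |z| < ε := by
  -- the point is four times `(55774, -1333248)`
  have hinf := cubicPoints_infinite (A := -45274) (B := -3233023860) (C := 149433462699144)
    (x := 83929928307408717953415229483210801 / 1550757330130100443302048217344)
    (y := 1179675725230308577547088188664584530605125031311959 /
      1931148913043624021473939619850055645250531328)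
    (by simp only [cubicPoints, Set.mem_ofPred_eq]; norm_num)
    (one_lt_padicNorm_of_odd_of_even (u := 83929928307408717953415229483210801)
      (v := 1550757330130100443302048217344) (by decide) (by decide) (by norm_num))
  have hlarge := exists_cubicPoints_gt (fun x hx => ?_) hinf
  · obtain ⟨u, v, h, hu⟩ := exists_quartic_point_near_zero (a := 28561) (b := 5468) (c := -45274)
      (d := 5468) (q := 169) (by norm_num) (by convert hlarge using 6 <;> norm_num) hε
    refine ⟨u, v, ?_, hu⟩
    rw [h]; push_cast; ring
  · have hx' : (x + 57122) * (x ^ 2 - 102396 * x + 2616040452) = 0 := by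
      push_cast at hx; linear_combination hx
    push_cast
    rcases mul_eq_zero.mp hx' with h | h <;> intro h'
    · obtain rfl : x = -57122 := by linarith
      norm_num at h'
    · nlinarith

theorem exists_isCurvePoint_four_thirds {ε : ℚ} (hε : 0 < ε) :
    ∃ t w : ℚ, IsCurvePoint (4 / 3) t w ∧ t ≠ 1 ∧ |t - 1| < ε ∧
      ((t ^ 2 - 1) * w) ^ 2 < (t ^ 4 + 1) ^ 2 := by
  obtain ⟨u, v, h, hu0, hu⟩ := quartic_points_near_one
    (ε := min (1 / 10) (ε / 4)) (lt_min (by norm_num) (by linarith))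
  obtain ⟨h1, h2⟩ := lt_min_iff.mp hu
  obtain ⟨h3, h4⟩ := abs_lt.mp h1
  have hden : 0 < 1 - u := by linarith
  refine ⟨(1 + u) / (1 - u), 2 * v / (27 * (1 - u) ^ 2), ?_, ?_, ?_, ?_⟩
  · unfold IsCurvePoint
    field_simp
    linear_combination 972 * h
  · intro e
    rw [div_eq_one_iff_eq hden.ne'] at e
    exact hu0 (by linarith)
  · have e : (1 + u) / (1 - u) - 1 = 2 * u / (1 - u) := by field_simp; ring
    rw [e, abs_div, abs_of_pos hden, div_lt_iff₀ hden, abs_mul, abs_two]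
    nlinarith
  · have e1 : ((((1 + u) / (1 - u)) ^ 2 - 1) * (2 * v / (27 * (1 - u) ^ 2))) ^ 2 =
        64 / 729 * u ^ 2 * v ^ 2 / (1 - u) ^ 8 := by field_simp; ring
    have e2 : (((1 + u) / (1 - u)) ^ 4 + 1) ^ 2 =
        ((1 + u) ^ 4 + (1 - u) ^ 4) ^ 2 / (1 - u) ^ 8 := by field_simp
    rw [e1, e2, h]
    gcongr
    have hu2 : u ^ 2 < 1 / 100 := by nlinarith
    have e3 : (1 + u) ^ 4 + (1 - u) ^ 4 = 2 + 12 * u ^ 2 + 2 * (u ^ 2) ^ 2 := by ring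
    have e4 : u ^ 4 = (u ^ 2) ^ 2 := by ring
    rw [e3, e4]
    -- at `u = 0` this reads `0 < 4`
    nlinarith [sq_nonneg u, sq_nonneg (u ^ 2)]

theorem exists_isCurvePoint_six {ε : ℚ} (hε : 0 < ε) :
    ∃ t w : ℚ, IsCurvePoint 6 t w ∧ t ≠ -3 ∧ |t + 3| < ε ∧
      (t ^ 4 + 1) ^ 2 < ((t ^ 2 - 1) * w) ^ 2 := by
  obtain ⟨z, v, h, hz0, hz⟩ := quartic_points_near_neg_three
    (ε := min (1 / 100) (ε / 16)) (lt_min (by norm_num) (by linarith))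
  obtain ⟨h1, h2⟩ := lt_min_iff.mp hz
  obtain ⟨h3, h4⟩ := abs_lt.mp h1
  have hden : 0 < 1 + 3 * z := by linarith
  refine ⟨-(3 + z) / (1 + 3 * z), 2 * v / (1 + 3 * z) ^ 2, ?_, ?_, ?_, ?_⟩
  · unfold IsCurvePoint
    field_simp
    linear_combination 12 * h
  · intro e
    rw [div_eq_iff hden.ne'] at e
    exact hz0 (by linarith)
  · have e : -(3 + z) / (1 + 3 * z) + 3 = 8 * z / (1 + 3 * z) := by field_simp; ring
    rw [e, abs_div, abs_of_pos hden, div_lt_iff₀ hden, abs_mul, abs_of_pos (by norm_num : (0:ℚ) < 8)]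
    nlinarith
  · have e1 : (((-(3 + z) / (1 + 3 * z)) ^ 2 - 1) * (2 * v / (1 + 3 * z) ^ 2)) ^ 2 =
        256 * (1 - z ^ 2) ^ 2 * v ^ 2 / (1 + 3 * z) ^ 8 := by field_simp; ring
    have e2 : ((-(3 + z) / (1 + 3 * z)) ^ 4 + 1) ^ 2 =
        ((3 + z) ^ 4 + (1 + 3 * z) ^ 4) ^ 2 / (1 + 3 * z) ^ 8 := by field_simp
    rw [e1, e2]
    gcongr
    -- at `z = 0` the two sides are `82 ^ 2` and `(16 * 169) ^ 2`
    have hz2 : z ^ 2 < 1 / 100 := by nlinarith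
    have b1 : (3 + z) ^ 4 ≤ 4 ^ 4 := by gcongr <;> linarith
    have b2 : (1 + 3 * z) ^ 4 ≤ 2 ^ 4 := by gcongr; linarith
    have b3 : (20000 : ℚ) ≤ v ^ 2 := by
      rw [h]
      nlinarith [sq_nonneg z, sq_nonneg (z ^ 2), sq_nonneg (z ^ 2 + z)]
    have b4 : (1 / 4 : ℚ) ≤ (1 - z ^ 2) ^ 2 := by nlinarith
    have b5 : 0 ≤ (3 + z) ^ 4 + (1 + 3 * z) ^ 4 := by positivity
    calc ((3 + z) ^ 4 + (1 + 3 * z) ^ 4) ^ 2 ≤ (4 ^ 4 + 2 ^ 4) ^ 2 := by gcongr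
      _ < 256 * (1 / 4) * 20000 := by norm_num
      _ ≤ 256 * (1 - z ^ 2) ^ 2 * v ^ 2 := by gcongr

/-- Modulo `3` the equation of the curve for `k = 4 / 3` reads `(m ^ 2 - n ^ 2) ^ 2 = 0`. -/
theorem IsCurvePoint.three_dvd {t w : ℚ} (h : IsCurvePoint (4 / 3) t w) :
    (3 : ℤ) ∣ t.num ^ 2 - (t.den : ℤ) ^ 2 := by
  have ht : (t.num : ℚ) = t * t.den := (Rat.mul_den_eq_num t).symm
  unfold IsCurvePoint at h
  obtain ⟨d, -, hd⟩ := exists_int_of_three_mul_sq (x := 9 * t.den ^ 2 * w)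
    (R := 1024 * (t.num ^ 2 - t.den ^ 2) ^ 2 + 3456 * t.num ^ 2 * t.den ^ 2
      - 1728 * t.num * t.den * (t.num ^ 2 + t.den ^ 2) + 243 * (t.num ^ 2 + t.den ^ 2) ^ 2) (by
    push_cast
    rw [ht]
    linear_combination 81 * t.den ^ 4 * h)
  have : (3 : ℤ) ∣ 1024 * (t.num ^ 2 - t.den ^ 2) ^ 2 := by
    refine ⟨d ^ 2 - 1152 * t.num ^ 2 * t.den ^ 2 + 576 * t.num * t.den * (t.num ^ 2 + t.den ^ 2)
      - 81 * (t.num ^ 2 + t.den ^ 2) ^ 2, ?_⟩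
    linarith
  rcases Int.prime_three.dvd_or_dvd this with h | h
  · norm_num at h
  · exact Int.prime_three.dvd_of_dvd_pow h

/-! ### Solutions of both signs -/

/-- A rational number near an integer, but different from it, has a large denominator. -/
theorem den_inv_le_abs_sub {t : ℚ} {z : ℤ} (h : t ≠ z) : 1 / (t.den : ℚ) ≤ |t - z| := by
  have hn : (0 : ℚ) < t.den := by exact_mod_cast t.den_pos
  rw [div_le_iff₀ hn, ← abs_of_pos hn, ← abs_mul, sub_mul, Rat.mul_den_eq_num]
  have : t.num - z * t.den ≠ 0 := fun h0 => h (by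
    rw [← Rat.num_div_den t, div_eq_iff hn.ne']
    exact_mod_cast sub_eq_zero.mp h0)
  exact_mod_cast Int.one_le_abs this

theorem exists_nontrivial_add_gt (N : ℕ) :
    ∃ x y a b : ℤ, 0 < x ∧ 0 < y ∧ 0 < a ∧ 0 < b ∧ IsNontrivialSolution 4 1 1 x y a b ∧
      (N : ℤ) < x + y := by
  obtain ⟨t, w, h, ht1, ht, hlt⟩ := exists_isCurvePoint_four_thirds
    (ε := 1 / (N + 1)) (by positivity)
  have hd : (0 : ℚ) < t.den := by exact_mod_cast t.den_pos
  have hnum : (t.num : ℚ) = t * t.den := (Rat.mul_den_eq_num t).symm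
  have ht0 : 0 < t := by
    have : (1 : ℚ) / (N + 1) ≤ 1 := by
      rw [div_le_one (by positivity)]; linarith [(Nat.cast_nonneg N : (0 : ℚ) ≤ N)]
    linarith [(abs_lt.mp ht).1]
  have hN : (N : ℤ) < t.den := by
    have := (den_inv_le_abs_sub (z := 1) (by exact_mod_cast ht1)).trans_lt
      (by exact_mod_cast ht)
    rw [one_div_lt_one_div hd (by positivity)] at this
    have : N + 1 < t.den := by exact_mod_cast this
    omega
  have hm0 : t.num ≠ 0 := (Rat.num_pos.mpr ht0).ne'
  have hn0 : (t.den : ℤ) ≠ 0 := by exact_mod_cast t.den_nz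
  obtain ⟨g, hg⟩ := h.three_dvd
  have hgq : (t.num : ℚ) ^ 2 - t.den ^ 2 = 3 * g := by exact_mod_cast hg
  have hf0 : 4 * g ≠ 0 := by
    intro h0
    obtain rfl : g = 0 := by omega
    rw [hnum] at hgq
    have : (t - 1) * ((t + 1) * t.den ^ 2) = 0 := by push_cast at hgq; linear_combination hgq
    rcases mul_eq_zero.mp this with h1 | h1
    · exact ht1 (sub_eq_zero.mp h1)
    · have : 0 < (t + 1) * (t.den : ℚ) ^ 2 := by positivity
      linarith
  obtain ⟨d, hfib, hdsq⟩ := h.exists_isFibrePoint (f := 4 * g) (by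
    rw [hgq]; push_cast; ring)
  have hgcd := IsFibrePoint.gcd_eq_one (p := 4) (q := 3)
    (Rat.isCoprime_num_den t) (by rw [hg]; ring) (f := 4 * g) ⟨2 * g, by ring⟩
    fun r hr hr1 hr2 => dvd_of_dvd_fourth_powers (l := 23) (by norm_num)
      fourth_powers_twenty_three hr (by exact_mod_cast hr1) hr2
  obtain ⟨x, y, a, b, hx, hy, ha, hb, hsol, hadd⟩ :=
    hfib.exists_nontrivial_add hm0 hn0 hf0 hgcd (by
      have : (d : ℚ) ^ 2 < (t.num ^ 4 + t.den ^ 4) ^ 2 := by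
        rw [hdsq, hnum]
        calc (t.den ^ 4 * ((t ^ 2 - 1) * w)) ^ 2 = t.den ^ 8 * ((t ^ 2 - 1) * w) ^ 2 := by ring
          _ < t.den ^ 8 * (t ^ 4 + 1) ^ 2 := by gcongr
          _ = _ := by ring
      exact abs_lt_of_sq_lt_sq (by exact_mod_cast this) (by positivity))
  refine ⟨x, y, a, b, hx, hy, ha, hb, hsol, ?_⟩
  have h1 : (t.den : ℤ) ≤ t.den ^ 4 := le_self_pow₀ (by omega) (by norm_num)
  have h2 : 0 ≤ t.num ^ 4 := by positivity
  linarith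

theorem exists_nontrivial_sub_gt (N : ℕ) :
    ∃ x y a b : ℤ, 0 < x ∧ 0 < y ∧ 0 < a ∧ 0 < b ∧ IsNontrivialSolution 4 (-1) 1 x y a b ∧
      (N : ℤ) < x + y := by
  obtain ⟨t, w, h, ht1, ht, hlt⟩ := exists_isCurvePoint_six (ε := 1 / (N + 1)) (by positivity)
  have hd : (0 : ℚ) < t.den := by exact_mod_cast t.den_pos
  have hnum : (t.num : ℚ) = t * t.den := (Rat.mul_den_eq_num t).symm
  have ht0 : t < 0 := by
    have : (1 : ℚ) / (N + 1) ≤ 1 := by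
      rw [div_le_one (by positivity)]; linarith [(Nat.cast_nonneg N : (0 : ℚ) ≤ N)]
    linarith [(abs_lt.mp ht).2]
  have hN : (N : ℤ) < t.den := by
    have := (den_inv_le_abs_sub (z := -3) (by exact_mod_cast ht1)).trans_lt
      (by push_cast; rwa [sub_neg_eq_add])
    rw [one_div_lt_one_div hd (by positivity)] at this
    have : N + 1 < t.den := by exact_mod_cast this
    omega
  have hm0 : t.num ≠ 0 := (Rat.num_neg.mpr ht0).ne
  have hn0 : (t.den : ℤ) ≠ 0 := by exact_mod_cast t.den_nz
  obtain ⟨d, hfib, hdsq⟩ := h.exists_isFibrePoint (f := 6 * (t.num ^ 2 - t.den ^ 2)) (by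
    push_cast; ring)
  have hgcd := IsFibrePoint.gcd_eq_one (p := 6) (q := 1)
    (Rat.isCoprime_num_den t) (one_mul _) ⟨3 * (t.num ^ 2 - t.den ^ 2), by ring⟩
    fun r hr hr1 hr2 => dvd_of_dvd_fourth_powers (l := 71) (by norm_num)
      fourth_powers_seventy_one hr (by exact_mod_cast hr1) hr2
  obtain ⟨x, y, a, b, hx, hy, ha, hb, hsol, hsub⟩ :=
    hfib.exists_nontrivial_sub hm0 hn0 hgcd (by
      have : (t.num ^ 4 + t.den ^ 4) ^ 2 < (d : ℚ) ^ 2 := by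
        rw [hdsq, hnum]
        calc ((t * t.den) ^ 4 + t.den ^ 4) ^ 2 = t.den ^ 8 * (t ^ 4 + 1) ^ 2 := by ring
          _ < t.den ^ 8 * ((t ^ 2 - 1) * w) ^ 2 := by gcongr
          _ = _ := by ring
      refine lt_of_pow_lt_pow_left₀ 2 (abs_nonneg d) ?_
      rw [sq_abs]
      exact_mod_cast this)
  refine ⟨x, y, a, b, hx, hy, ha, hb, hsol, ?_⟩
  have h1 : (t.den : ℤ) ≤ t.den ^ 4 := le_self_pow₀ (by omega) (by norm_num)
  have h2 : 0 ≤ t.num ^ 4 := by positivity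
  linarith

theorem mainTheorem1 (ε : ℤˣ) :
    {s : ℤ × ℤ × ℤ × ℤ | 0 < s.1 ∧ 0 < s.2.1 ∧ 0 < s.2.2.1 ∧ 0 < s.2.2.2 ∧
      IsNontrivialSolution 4 ε 1 s.1 s.2.1 s.2.2.1 s.2.2.2}.Infinite := by
  have key : ∀ N : ℕ, ∃ x y a b : ℤ, 0 < x ∧ 0 < y ∧ 0 < a ∧ 0 < b ∧
      IsNontrivialSolution 4 ε 1 x y a b ∧ (N : ℤ) < x + y := by
    rcases Int.units_eq_one_or ε with rfl | rfl
    · exact exists_nontrivial_add_gt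
    · exact exists_nontrivial_sub_gt
  intro hfin
  obtain ⟨M, hM⟩ := (hfin.image fun s => s.1 + s.2.1).bddAbove
  obtain ⟨x, y, a, b, hx, hy, ha, hb, hsol, hlt⟩ := key M.toNat
  have hle : x + y ≤ M := hM ⟨(x, y, a, b), ⟨hx, hy, ha, hb, hsol⟩, rfl⟩
  have := Int.self_le_toNat M
  linarith
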